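/- Let $q$ be a power of a prime $p$, let $n\ge 1$, and let $f,g\in\mathbb F_{q^2}[x]$ with $g\mid x^n-1$. Identify $\mathbb F_{q^2}^{2n}$ with $R_n^2$, $R_n=\mathbb F_{q^2}[x]/\langle x^n-1\rangle$, by sending $(a_0,\dots,a_{n-1},b_0,\dots,b_{n-1})$ to $(\sum a_ix^i,\sum b_ix^i)$, and let $\mathcal C=\mathcal C_{q^2}(f,g)\subseteq\mathbb F_{q^2}^{2n}$ be the quasi-cyclic code of index 2 that corresponds to the $R_n$-submodule of $R_n^2$ generated by $(g,fg)$. Write $\langle u,v\rangle_h=\sum_i u_i^qv_i$ for the Hermitian inner product, $\mathcal D^{\perp_h}=\{v:\langle u,v\rangle_h=0\ \forall u\in\mathcal D\}$ for the Hermitian dual of a linear code $\mathcal D$, $d(\mathcal D)$ for its minimum distance (the smallest Hamming weight of a nonzero codeword), and $d^{\perp_h}=d(\mathcal C^{\perp_h})$. Let $\mathcal C_1,\mathcal C_2\subseteq\mathbb F_{q^2}^n$ be the projections of $\mathcal C$ onto the first and the last $n$ coordinates. Assume that $\mathcal C$ is Hermitian self-orthogonal, $\mathcal C\subseteq\mathcal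 C^{\perp_h}$. A quantum code $[[N,k,d]]_q$ is a subspace $Q\subseteq(\mathbb C^q)^{\otimes N}$ of dimension $q^k$ with minimum distance at least $d$: if $P$ is the orthogonal projection onto $Q$, then for every error operator $E=A_1\otimes\cdots\otimes A_N$ with fewer than $d$ factors $A_i\ne I$ there is a scalar $c_E$ with $PEP=c_EP$; if $\dim Q=1$, it is required moreover that $c_E=q^{-N}\operatorname{tr}E$ for all these $E$ (purity). (i) Let $x^{(1)}\in\mathcal C_1^{\perp_h}$ with $\langle x^{(1)},x^{(1)}\rangle_h=p-1$ in $\mathbb F_{q^2}$, and let $\mathcal C'$ be the linear code of length $2n+1$ spanned by the vectors $(c,0)$, $c\in\mathcal C$, and $(x^{(1)},0,\dots,0,1)$. Then there is a quantum code with parameters $$[[2n+1,\ 2\deg g-1,\ d(\mathcal C'^{\perp_h})]]_q,\qquad\text{and}\qquad d^{\perp_h}\le d(\mathcal C'^{\perp_h})\le d^{\perp_h}+1.$$ (ii) Let moreover $x^{(2)}\in\mathcal C_2^{\perp_h}$ with $\langle x^{(2)},x^{(2)}\rangle_h=p-1$, and let $\mathcal C''$ be the linear code of length $2n+2$ spanned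 by the vectors $(c,0,0)$, $c\in\mathcal C$, together with $(x^{(1)},0,\dots,0,1,0)$ and $(0,\dots,0,x^{(2)},0,1)$. Then there is a quantum code with parameters $$[[2n+2,\ 2\deg g-2,\ d(\mathcal C''^{\perp_h})]]_q,\qquad\text{and}\qquad d^{\perp_h}\le d(\mathcal C''^{\perp_h})\le d^{\perp_h}+2.$$ -/

import Mathlib

open Polynomial

noncomputable section

/-! ### Linear codes and the Hermitian inner product -/

section Codes

variable {F : Type*} [Field F] {ι κ : Type*} [Fintype ι]

/-- The Hermitian inner product `⟨u, v⟩_h = ∑ i, u_i ^ q * v_i` (over a field with `q ^ 2` elements,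
where `a ↦ a ^ q` is the conjugation). -/
def hermInner (q : ℕ) (u v : ι → F) : F := ∑ i, u i ^ q * v i

/-- The Hermitian dual code `{v | ⟨u, v⟩_h = 0 for all u ∈ C}`. -/
def hermDual (q : ℕ) (C : Submodule F (ι → F)) : Submodule F (ι → F) where
  carrier := {v | ∀ u ∈ C, hermInner q u v = 0}
  add_mem' := by
    intro a b ha hb u hu
    have h1 := ha u hu
    have h2 := hb u hu
    simp only [hermInner] at h1 h2 ⊢
    simp [mul_add, Finset.sum_add_distrib, h1, h2]
  zero_mem' := by
    intro u _
    simp [hermInner]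
  smul_mem' := by
    intro c a ha u hu
    have h1 := ha u hu
    simp only [hermInner] at h1 ⊢
    simp only [Pi.smul_apply, smul_eq_mul, mul_left_comm _ c, ← Finset.mul_sum, h1, mul_zero]

/-- A code is Hermitian self-orthogonal if it is contained in its Hermitian dual. -/
def IsHermSelfOrthogonal (q : ℕ) (C : Submodule F (ι → F)) : Prop := C ≤ hermDual q C

open Classical in
/-- The minimum distance of a linear code: the smallest Hamming weight of a nonzero codeword
(a meaningful value as soon as the code is nonzero). -/
def minDist (C : Submodule F (ι → F)) : ℕ :=
  sInf {w | ∃ c ∈ C, c ≠ 0 ∧ hammingNorm c = w}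

end Codes

/-! ### Index-2 one-generator quasi-cyclic codes and their extensions -/

section QuasiCyclic

variable {F : Type*} [Field F] {n : ℕ}

/-- The ring `R_n = F[x] / ⟨x ^ n - 1⟩`. -/
abbrev CycRing (F : Type*) [Field F] (n : ℕ) : Type _ := AdjoinRoot (X ^ n - 1 : F[X])

/-- The identification of `(a_0, …, a_{n-1})` with `a_0 + a_1 x + ⋯ + a_{n-1} x ^ (n-1)` in `R_n`. -/
def vecToCyc (F : Type*) [Field F] (n : ℕ) : (Fin n → F) →ₗ[F] CycRing F n :=
  ∑ i : Fin n, (LinearMap.proj i : (Fin n → F) →ₗ[F] F).smulRight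
    (AdjoinRoot.root (X ^ n - 1 : F[X]) ^ (i : ℕ))

/-- The identification of `(a_0, …, a_{n-1}, b_0, …, b_{n-1})` with `(a(x), b(x))` in `R_n ^ 2`. The
first block of coordinates is indexed by `Sum.inl`, the second one by `Sum.inr`. -/
def vecToCyc₂ (F : Type*) [Field F] (n : ℕ) :
    (Fin n ⊕ Fin n → F) →ₗ[F] CycRing F n × CycRing F n :=
  (vecToCyc F n ∘ₗ LinearMap.funLeft F F Sum.inl).prod
    (vecToCyc F n ∘ₗ LinearMap.funLeft F F Sum.inr)

/-- The quasi-cyclic code of length `2n` and index 2 over `F` corresponding to the `R_n`-submodule of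
`R_n ^ 2` generated by `(g(x), f(x) g(x))`. -/
def qcCode (n : ℕ) (f g : F[X]) : Submodule F (Fin n ⊕ Fin n → F) :=
  ((Submodule.span (CycRing F n)
      {((AdjoinRoot.mk (X ^ n - 1 : F[X]) g, AdjoinRoot.mk (X ^ n - 1 : F[X]) (f * g)) :
        CycRing F n × CycRing F n)}).restrictScalars F).comap (vecToCyc₂ F n)

/-- The code `C₁` generated by the left half `G₁` of a generator matrix `(G₁, G₂)` of `C`. -/
def leftCode (C : Submodule F (Fin n ⊕ Fin n → F)) : Submodule F (Fin n → F) :=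
  C.map (LinearMap.funLeft F F Sum.inl)

/-- The code `C₂` generated by the right half `G₂` of a generator matrix `(G₁, G₂)` of `C`. -/
def rightCode (C : Submodule F (Fin n ⊕ Fin n → F)) : Submodule F (Fin n → F) :=
  C.map (LinearMap.funLeft F F Sum.inr)

/-- The extended code `C'` of length `2n + 1`, spanned by the rows `(c, 0)`, `c ∈ C`, and the row
`(x₁, 0, 1)`. -/
def extCode₁ (C : Submodule F (Fin n ⊕ Fin n → F)) (x₁ : Fin n → F) :
    Submodule F ((Fin n ⊕ Fin n) ⊕ Fin 1 → F) :=
  Submodule.span F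
    ({w | ∃ c ∈ C, w = Sum.elim c (0 : Fin 1 → F)} ∪ {Sum.elim (Sum.elim x₁ (0 : Fin n → F)) ![1]})

/-- The extended code `C''` of length `2n + 2`, spanned by the rows `(c, 0, 0)`, `c ∈ C`, and the rows
`(x₁, 0, 1, 0)` and `(0, x₂, 0, 1)`. -/
def extCode₂ (C : Submodule F (Fin n ⊕ Fin n → F)) (x₁ x₂ : Fin n → F) :
    Submodule F ((Fin n ⊕ Fin n) ⊕ Fin 2 → F) :=
  Submodule.span F
    ({w | ∃ c ∈ C, w = Sum.elim c (0 : Fin 2 → F)} ∪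
      {Sum.elim (Sum.elim x₁ (0 : Fin n → F)) ![1, 0], Sum.elim (Sum.elim (0 : Fin n → F) x₂) ![0, 1]})

end QuasiCyclic

/-! ### Quantum error-correcting codes -/

section Quantum

/-- The Hilbert space `(ℂ^q)^{⊗N}`, with its orthonormal basis `|a_1 … a_N⟩` indexed by words. -/
abbrev QuditSpace (q N : ℕ) : Type := EuclideanSpace ℂ (Fin N → Fin q)

/-- The matrix of the product operator `A_1 ⊗ ⋯ ⊗ A_N` in the basis of words. -/
def tensorMatrix {q N : ℕ} (A : Fin N → Matrix (Fin q) (Fin q) ℂ) :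
    Matrix (Fin N → Fin q) (Fin N → Fin q) ℂ :=
  Matrix.of fun a b => ∏ i, A i (a i) (b i)

/-- The product operator `A_1 ⊗ ⋯ ⊗ A_N` on `(ℂ^q)^{⊗N}`. -/
def tensorOp {q N : ℕ} (A : Fin N → Matrix (Fin q) (Fin q) ℂ) :
    QuditSpace q N →ₗ[ℂ] QuditSpace q N :=
  Matrix.toEuclideanLin (tensorMatrix A)

open Classical in
/-- The weight of a product error: the number of tensor factors different from the identity. -/
def errorWeight {q N : ℕ} (A : Fin N → Matrix (Fin q) (Fin q) ℂ) : ℕ :=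
  (Finset.univ.filter fun i => A i ≠ 1).card

/-- The subspace `Q` detects the error `A_1 ⊗ ⋯ ⊗ A_N`, i.e. `P E P = c P` for some scalar `c`, where
`P` is the orthogonal projection onto `Q` and `E` the error. -/
def DetectsError {q N : ℕ} (Q : Submodule ℂ (QuditSpace q N))
    (A : Fin N → Matrix (Fin q) (Fin q) ℂ) : Prop :=
  ∃ c : ℂ, ∀ u ∈ Q, ∀ v ∈ Q, inner ℂ u (tensorOp A v) = c * inner ℂ u v

/-- The subspace `Q` is pure with respect to the error `E = A_1 ⊗ ⋯ ⊗ A_N`: it detects `E` with scalar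
the normalized trace of `E`; in particular `P E P = 0` for traceless `E`. -/
def PureForError {q N : ℕ} (Q : Submodule ℂ (QuditSpace q N))
    (A : Fin N → Matrix (Fin q) (Fin q) ℂ) : Prop :=
  ∀ u ∈ Q, ∀ v ∈ Q,
    inner ℂ u (tensorOp A v) = ((tensorMatrix A).trace / (q : ℂ) ^ N) * inner ℂ u v

/-- `Q` is an `[[N, k, d]]_q` quantum error-correcting code: a `q ^ k`-dimensional subspace of
`(ℂ^q)^{⊗N}` which detects all errors of weight less than `d`. As detection is an empty condition on
one-dimensional subspaces, these are required to be pure, which is the usual convention. -/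
structure IsQECC (q N : ℕ) (k : ℤ) (d : ℕ) (Q : Submodule ℂ (QuditSpace q N)) : Prop where
  dim_eq : (Module.finrank ℂ Q : ℚ) = (q : ℚ) ^ k
  detects : ∀ A : Fin N → Matrix (Fin q) (Fin q) ℂ, errorWeight A < d → DetectsError Q A
  pure_of_dim_one : Module.finrank ℂ Q = 1 →
    ∀ A : Fin N → Matrix (Fin q) (Fin q) ℂ, errorWeight A < d → PureForError Q A

end Quantum

end

/-!
The vectors added to `C` have norm `p - 1 = -1` and are orthogonal to `C`, so that the new
coordinates, which contribute `1` to the norm of each added row and nothing to the other products,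
make the extended code Hermitian self-orthogonal (`isHermSelfOrthogonal_extendCode`). Its dual
projects bijectively onto the dual of `C`, the added coordinates being determined by the old ones;
this gives both bounds for the minimum distance (`minDist_hermDual_extendCode`). Since `C` has
dimension `n - deg g` (`finrank_qcCode_add`), the parameters follow from the stabilizer
construction (`exists_isQECC_of_isHermSelfOrthogonal`): a Hermitian self-orthogonal code `C` of
length `N` and dimension `k` over the field `F` with `q ^ 2` elements yields a pure `[[N, N - 2k,
d(C^⊥)]]` code.

The latter is proved as follows. Let `K` be the fixed field of `a ↦ a ^ q`, and `F = K ⊕ γ K`. The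
Weyl operators `X(x) Z(z)` on functions on `K`, indexed by `x + γ z ∈ F`, are unitary, form a
basis of all `q × q` matrices, and commute up to the scalars `ψ (a ^ q b - a b ^ q)` for an
additive character `ψ` (`exists_isNiceErrorBasis`). Their tensor products, indexed by words over
`F`, therefore commute up to `ψ (h - h ^ q)`, where `h` is the Hermitian product of the two words.
So the words of `C` give commuting operators, which have a common eigenvector; its eigenvalues `χ
s` turn `s ↦ (χ s)⁻¹ D s` into a representation of `C`, and the average of these operators is the
projection onto a joint eigenspace `Q`. All operators but the identity are traceless, so `dim Q =
q ^ N / |C|` (`IsNiceErrorBasis.exists_jointEigenspace`). A nonzero word `w` of weight less than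
`d(C^⊥)` is not in `C^⊥`, hence fails to commute with some `s ∈ C`, so its operator maps `Q` into
another joint eigenspace, orthogonal to `Q`; expanding an error of such a weight in the error
basis, only the multiple of the identity survives (`IsNiceErrorBasis.pureForError`).
-/

noncomputable section

/-! ### Product operators and joint eigenvectors -/

open scoped Matrix

/-- A finite commuting family of endomorphisms of a nonzero finite-dimensional space over an
algebraically closed field has a common eigenvector. -/
theorem exists_common_eigenvector {K V ι : Type*} [Field K] [IsAlgClosed K] [AddCommGroup V]
    [Module K V] [FiniteDimensional K V] [Nontrivial V] [Finite ι] (f : ι → Module.End K V)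
    (h : ∀ i j, Commute (f i) (f j)) :
    ∃ v : V, v ≠ 0 ∧ ∃ χ : ι → K, ∀ i, f i v = χ i • v := by
  classical
  cases nonempty_fintype ι
  have key : ∀ A : Finset ι, ∃ W : Submodule K V, W ≠ ⊥ ∧ (∀ i, ∀ v ∈ W, f i v ∈ W) ∧
      ∀ i ∈ A, ∃ c : K, ∀ v ∈ W, f i v = c • v := by
    intro A
    induction A using Finset.induction_on with
    | empty => exact ⟨⊤, top_ne_bot, by simp, by simp⟩
    | insert j A _ ih =>
      obtain ⟨W, hW, hinv, hsc⟩ := ih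
      have : Nontrivial W := Submodule.nontrivial_iff_ne_bot.2 hW
      obtain ⟨μ, hμ⟩ := Module.End.exists_eigenvalue ((f j).restrict (hinv j))
      obtain ⟨w, hw⟩ := hμ.exists_hasEigenvector
      refine ⟨W ⊓ Module.End.eigenspace (f j) μ, ?_, ?_, ?_⟩
      · refine (Submodule.ne_bot_iff _).2 ⟨w, ⟨w.2, ?_⟩, by simpa using hw.2⟩
        exact Module.End.mem_eigenspace_iff.2 (congrArg Subtype.val hw.apply_eq_smul)
      · rintro i v ⟨hv, hv'⟩
        refine ⟨hinv i v hv, ?_⟩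
        rw [SetLike.mem_coe, Module.End.mem_eigenspace_iff] at hv' ⊢
        have := LinearMap.congr_fun (h j i).eq v
        simp only [Module.End.mul_apply] at this
        rw [this, hv', map_smul]
      · intro i hi
        rcases Finset.mem_insert.1 hi with rfl | hi
        · exact ⟨μ, fun v hv => Module.End.mem_eigenspace_iff.1 hv.2⟩
        · obtain ⟨c, hc⟩ := hsc i hi
          exact ⟨c, fun v hv => hc v hv.1⟩
  obtain ⟨W, hW, -, hsc⟩ := key Finset.univ
  obtain ⟨v, hv, hv0⟩ := (Submodule.ne_bot_iff _).1 hW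
  choose χ hχ using fun i => hsc i (Finset.mem_univ i)
  exact ⟨v, hv0, χ, fun i => hχ i v hv⟩

section Tensor

variable {q N : ℕ}

theorem tensorMatrix_mul (A B : Fin N → Matrix (Fin q) (Fin q) ℂ) :
    tensorMatrix A * tensorMatrix B = tensorMatrix fun i => A i * B i := by
  ext a b
  simp only [tensorMatrix, Matrix.mul_apply, Matrix.of_apply, Finset.prod_univ_sum,
    Fintype.piFinset_univ, Finset.prod_mul_distrib]

theorem tensorMatrix_one :
    tensorMatrix (fun _ : Fin N => (1 : Matrix (Fin q) (Fin q) ℂ)) = 1 := by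
  ext a b
  simp only [tensorMatrix, Matrix.of_apply, Matrix.one_apply]
  by_cases h : a = b
  · simp [h]
  · obtain ⟨i, hi⟩ := Function.ne_iff.1 h
    rw [if_neg h]
    exact Finset.prod_eq_zero (Finset.mem_univ i) (if_neg hi)

theorem trace_tensorMatrix (A : Fin N → Matrix (Fin q) (Fin q) ℂ) :
    (tensorMatrix A).trace = ∏ i, (A i).trace := by
  simp only [tensorMatrix, Matrix.trace, Matrix.diag_apply, Matrix.of_apply,
    Finset.prod_univ_sum, Fintype.piFinset_univ]

theorem conjTranspose_tensorMatrix (A : Fin N → Matrix (Fin q) (Fin q) ℂ) :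
    (tensorMatrix A)ᴴ = tensorMatrix fun i => (A i)ᴴ := by
  ext a b
  simp [tensorMatrix, Matrix.conjTranspose_apply]

theorem tensorMatrix_smul (c : Fin N → ℂ) (A : Fin N → Matrix (Fin q) (Fin q) ℂ) :
    (tensorMatrix fun i => c i • A i) = (∏ i, c i) • tensorMatrix A := by
  ext a b
  simp [tensorMatrix, Finset.prod_mul_distrib]

theorem tensorMatrix_sum {G : Type*} [Fintype G] (D : G → Matrix (Fin q) (Fin q) ℂ)
    (k : Fin N → G → ℂ) :
    (tensorMatrix fun i => ∑ a, k i a • D a) =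
      ∑ w : Fin N → G, (∏ i, k i (w i)) • tensorMatrix fun i => D (w i) := by
  classical
  ext a b
  simp only [tensorMatrix, Matrix.of_apply, Matrix.sum_apply, Matrix.smul_apply, smul_eq_mul,
    Finset.prod_univ_sum, Fintype.piFinset_univ, Finset.prod_mul_distrib]

theorem trace_toEuclideanLin {m : Type*} [Fintype m] [DecidableEq m] (M : Matrix m m ℂ) :
    LinearMap.trace ℂ _ (Matrix.toEuclideanLin M) = M.trace := by
  unfold Matrix.toEuclideanLin
  rw [Matrix.toLpLin_eq_toLin, Matrix.trace_toLin_eq]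

theorem toEuclideanLin_mul_apply {m : Type*} [Fintype m] [DecidableEq m] (M M' : Matrix m m ℂ)
    (v : EuclideanSpace ℂ m) :
    Matrix.toEuclideanLin (M * M') v = Matrix.toEuclideanLin M (Matrix.toEuclideanLin M' v) := by
  simp [Matrix.toLpLin_apply, Matrix.mulVec_mulVec]

theorem toEuclideanLin_one_apply {m : Type*} [Fintype m] [DecidableEq m]
    (v : EuclideanSpace ℂ m) : Matrix.toEuclideanLin (1 : Matrix m m ℂ) v = v := by
  simp

/-- An isometry `M` with `M u = c u` satisfies `⟨u, x⟩ = c̄ ⟨u, M x⟩`. -/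
theorem inner_eq_of_eigenvector {m : Type*} [Fintype m] [DecidableEq m] {M : Matrix m m ℂ}
    (hM : Mᴴ * M = 1) {u : EuclideanSpace ℂ m} {c : ℂ} (hu : Matrix.toEuclideanLin M u = c • u)
    (x : EuclideanSpace ℂ m) :
    inner ℂ u x = star c * inner ℂ u (Matrix.toEuclideanLin M x) := by
  have h1 : inner ℂ (Matrix.toEuclideanLin M u) (Matrix.toEuclideanLin M x) = inner ℂ u x := by
    rw [← LinearMap.adjoint_inner_right, ← Matrix.toEuclideanLin_conjTranspose_eq_adjoint,
      ← toEuclideanLin_mul_apply, hM, toEuclideanLin_one_apply]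
  rw [← h1, hu, inner_smul_left]
  rfl

end Tensor

/-! ### Nice error bases and stabilizer codes -/

/-- A nice error basis of `ℂ^q` indexed by an abelian group `G`, together with its commutation
factors `β`: unitary matrices `D a` which form a projective representation of `G`, commute up to the
scalars `β a b`, and are traceless for `a ≠ 0`. The cocycle of the representation is left implicit:
only its existence matters. -/
structure IsNiceErrorBasis {G : Type*} [AddCommGroup G] {q : ℕ}
    (D : G → Matrix (Fin q) (Fin q) ℂ) (β : G → G → ℂ) : Prop where
  map_zero : D 0 = 1
  map_add : ∀ a b, ∃ c : ℂ, D a * D b = c • D (a + b)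
  comm : ∀ a b, D a * D b = β a b • (D b * D a)
  conjTranspose_mul_self : ∀ a, (D a)ᴴ * D a = 1
  trace_eq_zero : ∀ a, a ≠ 0 → (D a).trace = 0

namespace IsNiceErrorBasis

variable {G : Type*} [AddCommGroup G] {q N : ℕ} {D : G → Matrix (Fin q) (Fin q) ℂ}
  {β : G → G → ℂ}

/-- The `D a` are pairwise orthogonal for the trace form. -/
theorem trace_conjTranspose_mul (hD : IsNiceErrorBasis D β) {a b : G} (hab : a ≠ b) :
    ((D a)ᴴ * D b).trace = 0 := by
  obtain ⟨c, hc⟩ := hD.map_add a (b - a)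
  rw [add_sub_cancel] at hc
  have h1 : D (b - a) = c • ((D a)ᴴ * D b) := by
    rw [← Matrix.mul_smul, ← hc, ← Matrix.mul_assoc, hD.conjTranspose_mul_self, Matrix.one_mul]
  rcases eq_or_ne c 0 with rfl | hc0
  · have h2 := hD.conjTranspose_mul_self (b - a)
    rw [h1, zero_smul, Matrix.mul_zero] at h2
    rw [← Matrix.one_mul ((D a)ᴴ * D b), ← h2, Matrix.zero_mul, Matrix.trace_zero]
  · have h2 := hD.trace_eq_zero (b - a) (sub_ne_zero.2 hab.symm)
    rw [h1, Matrix.trace_smul, smul_eq_mul] at h2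
    exact (mul_eq_zero.1 h2).resolve_left hc0

theorem linearIndependent [Fintype G] (hD : IsNiceErrorBasis D β) (hq : 0 < q) :
    LinearIndependent ℂ D := by
  rw [Fintype.linearIndependent_iff]
  intro k hk a
  have h := congrArg (fun M => ((D a)ᴴ * M).trace) hk
  simp only [Matrix.mul_sum, Matrix.trace_sum, Matrix.mul_smul, Matrix.trace_smul,
    Matrix.mul_zero, Matrix.trace_zero] at h
  rw [Finset.sum_eq_single a (fun b _ hb => by rw [hD.trace_conjTranspose_mul hb.symm, smul_zero])
    (by simp), hD.conjTranspose_mul_self, Matrix.trace_one, Fintype.card_fin, smul_eq_mul] at h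
  exact (mul_eq_zero.1 h).resolve_right (by exact_mod_cast hq.ne')

/-- Every matrix is a linear combination of the `q ^ 2` matrices of a nice error basis. -/
theorem exists_eq_sum [Fintype G] (hD : IsNiceErrorBasis D β) (hq : 0 < q)
    (hG : Fintype.card G = q ^ 2) (A : Matrix (Fin q) (Fin q) ℂ) :
    ∃ k : G → ℂ, A = ∑ a, k a • D a := by
  have h := (hD.linearIndependent hq).span_eq_top_of_card_eq_finrank' (by
    rw [hG, Module.finrank_matrix, Fintype.card_fin, Module.finrank_self, mul_one, sq])
  have hA : A ∈ Submodule.span ℂ (Set.range D) := h ▸ Submodule.mem_top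
  obtain ⟨k, hk⟩ := (Submodule.mem_span_range_iff_exists_fun ℂ).1 hA
  exact ⟨k, hk.symm⟩

theorem trace_sum_smul [Fintype G] (hD : IsNiceErrorBasis D β) (k : G → ℂ) :
    (∑ a, k a • D a).trace = k 0 * q := by
  rw [Matrix.trace_sum, Finset.sum_eq_single 0 (fun b _ hb => by
    rw [Matrix.trace_smul, hD.trace_eq_zero b hb, smul_zero]) (by simp), hD.map_zero,
    Matrix.trace_smul, Matrix.trace_one, Fintype.card_fin, smul_eq_mul]

theorem exists_tensorMatrix_mul (hD : IsNiceErrorBasis D β) (s t : Fin N → G) :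
    ∃ c : ℂ, (tensorMatrix fun i => D (s i)) * (tensorMatrix fun i => D (t i)) =
      c • tensorMatrix fun i => D ((s + t) i) := by
  choose c hc using fun i => hD.map_add (s i) (t i)
  exact ⟨∏ i, c i, by rw [tensorMatrix_mul, ← tensorMatrix_smul]; simp only [hc, Pi.add_apply]⟩

theorem tensorMatrix_comm (hD : IsNiceErrorBasis D β) (s t : Fin N → G) :
    (tensorMatrix fun i => D (s i)) * (tensorMatrix fun i => D (t i)) =
      (∏ i, β (s i) (t i)) •
        ((tensorMatrix fun i => D (t i)) * tensorMatrix fun i => D (s i)) := by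
  rw [tensorMatrix_mul, tensorMatrix_mul, ← tensorMatrix_smul]
  simp only [← hD.comm]

theorem tensorMatrix_isometry (hD : IsNiceErrorBasis D β) (s : Fin N → G) :
    (tensorMatrix fun i => D (s i))ᴴ * (tensorMatrix fun i => D (s i)) = 1 := by
  rw [conjTranspose_tensorMatrix, tensorMatrix_mul]
  simp only [hD.conjTranspose_mul_self, tensorMatrix_one]

theorem tensorMatrix_zero (hD : IsNiceErrorBasis D β) :
    (tensorMatrix fun i => D ((0 : Fin N → G) i)) = 1 := by
  simp only [Pi.zero_apply, hD.map_zero, tensorMatrix_one]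

theorem trace_tensorMatrix_eq_zero (hD : IsNiceErrorBasis D β) {s : Fin N → G} (hs : s ≠ 0) :
    (tensorMatrix fun i => D (s i)).trace = 0 := by
  obtain ⟨i, hi⟩ := Function.ne_iff.1 hs
  rw [trace_tensorMatrix]
  exact Finset.prod_eq_zero (Finset.mem_univ i) (hD.trace_eq_zero _ hi)

/-- **Purity of joint eigenspaces.** Let `Q` consist of common eigenvectors of the operators
`D s`, `s ∈ S`, with joint eigenvalues independent of the vector. If every nonzero word `w` of
weight less than `d` fails to commute with some element of `S`, then `Q` is pure for all errors of
weight less than `d`. -/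
theorem pureForError [Fintype G] [DecidableEq G] (hD : IsNiceErrorBasis D β) (hq : 0 < q)
    (hG : Fintype.card G = q ^ 2) (S : AddSubgroup (Fin N → G))
    (Q : Submodule ℂ (QuditSpace q N)) (χ : S → ℂ)
    (hQ : ∀ v ∈ Q, ∀ s : S, tensorOp (fun i => D (s.1 i)) v = χ s • v) {d : ℕ}
    (hd : ∀ w : Fin N → G, w ≠ 0 → hammingNorm w < d → ∃ s ∈ S, ∏ i, β (s i) (w i) ≠ 1)
    (A : Fin N → Matrix (Fin q) (Fin q) ℂ) (hA : errorWeight A < d) : PureForError Q A := by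
  intro u hu v hv
  rcases eq_or_ne u 0 with rfl | hu0
  · simp
  -- An error outside the commutant of `S` maps `Q` into its orthogonal complement.
  have orth : ∀ w : Fin N → G, (∃ s ∈ S, ∏ i, β (s i) (w i) ≠ 1) →
      inner ℂ u (tensorOp (fun i => D (w i)) v) = 0 := by
    rintro w ⟨s, hs, hsw⟩
    have hu' := hQ u hu ⟨s, hs⟩
    have hv' := hQ v hv ⟨s, hs⟩
    simp only at hu' hv'
    have hiso := hD.tensorMatrix_isometry s
    have h1 := inner_eq_of_eigenvector hiso hu' u
    have h2 := inner_eq_of_eigenvector hiso hu' (tensorOp (fun i => D (w i)) v)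
    have hu'' : Matrix.toEuclideanLin (tensorMatrix fun i => D (s i)) u = χ ⟨s, hs⟩ • u := hu'
    have hv'' : Matrix.toEuclideanLin (tensorMatrix fun i => D (s i)) v = χ ⟨s, hs⟩ • v := hv'
    rw [hu'', inner_smul_right, ← mul_assoc, eq_comm] at h1
    have hn := mul_right_eq_self₀.1 ((mul_comm _ _).trans h1)
    replace hn := hn.resolve_right (inner_self_ne_zero.2 hu0)
    unfold tensorOp at h2
    rw [← toEuclideanLin_mul_apply, hD.tensorMatrix_comm, map_smul, LinearMap.smul_apply,
      toEuclideanLin_mul_apply, hv'', map_smul, inner_smul_right, inner_smul_right] at h2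
    have h3 : inner ℂ u (tensorOp (fun i => D (w i)) v) =
        (∏ i, β (s i) (w i)) * inner ℂ u (tensorOp (fun i => D (w i)) v) := by
      unfold tensorOp
      linear_combination h2 + (∏ i, β (s i) (w i)) *
        inner ℂ u (Matrix.toEuclideanLin (tensorMatrix fun i => D (w i)) v) * hn
    exact (mul_left_eq_self₀.1 h3.symm).resolve_left hsw
  have hk : ∀ i, ∃ k : G → ℂ, A i = ∑ a, k a • D a ∧ (A i = 1 → ∀ a ≠ 0, k a = 0) := by
    intro i
    by_cases hi : A i = 1
    · refine ⟨Pi.single 0 1, ?_, fun _ a ha => by simp [ha]⟩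
      rw [Finset.sum_eq_single 0 (fun b _ hb => by simp [hb]) (by simp), hi, hD.map_zero]
      simp
    · obtain ⟨k, hk⟩ := hD.exists_eq_sum hq hG (A i)
      exact ⟨k, hk, fun h => absurd h hi⟩
  choose k hk hk' using hk
  have hE : tensorMatrix A = ∑ w : Fin N → G, (∏ i, k i (w i)) • tensorMatrix fun i => D (w i) := by
    rw [← tensorMatrix_sum]
    exact congrArg tensorMatrix (funext hk)
  have htr : (tensorMatrix A).trace = (∏ i, k i 0) * (q : ℂ) ^ N := by
    rw [trace_tensorMatrix]
    simp only [hk, hD.trace_sum_smul, Finset.prod_mul_distrib, Finset.prod_const,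
      Finset.card_univ, Fintype.card_fin]
  have hq' : (q : ℂ) ^ N ≠ 0 := pow_ne_zero _ (by exact_mod_cast hq.ne')
  rw [htr, mul_div_cancel_right₀ _ hq']
  have hsum : tensorOp A v =
      ∑ w : Fin N → G, (∏ i, k i (w i)) • tensorOp (fun i => D (w i)) v := by
    unfold tensorOp
    rw [hE, map_sum, LinearMap.sum_apply]
    simp only [map_smul, LinearMap.smul_apply]
  rw [hsum, inner_sum, Finset.sum_eq_single 0 _ (by simp)]
  · rw [inner_smul_right]
    unfold tensorOp
    rw [hD.tensorMatrix_zero, toEuclideanLin_one_apply]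
    rfl
  · intro w _ hw
    rw [inner_smul_right]
    by_cases hs : ∀ i, w i ≠ 0 → A i ≠ 1
    · have hw' : hammingNorm w ≤ errorWeight A :=
        Finset.card_le_card fun i hi => by simpa using hs i (by simpa using hi)
      rw [orth w (hd w hw (hw'.trans_lt hA)), mul_zero]
    · push Not at hs
      obtain ⟨i, hwi, hAi⟩ := hs
      rw [Finset.prod_eq_zero (Finset.mem_univ i) (hk' i hAi _ hwi), zero_mul]

/-- **Stabilizer codes.** A finite abelian group of mutually commuting product operators in a nice
error basis has a joint eigenspace of dimension `q ^ N / |S|`. The eigenvalues are read off from a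
common eigenvector; they make `s ↦ (χ s)⁻¹ D s` a homomorphism, whose average is the projection
onto the eigenspace. -/
theorem exists_jointEigenspace [Finite G] (hD : IsNiceErrorBasis D β) (hq : 0 < q)
    (S : AddSubgroup (Fin N → G)) (hS : ∀ s ∈ S, ∀ t ∈ S, ∏ i, β (s i) (t i) = 1) :
    ∃ (Q : Submodule ℂ (QuditSpace q N)) (χ : S → ℂ),
      (∀ v ∈ Q, ∀ s : S, tensorOp (fun i => D (s.1 i)) v = χ s • v) ∧
      Module.finrank ℂ Q * Nat.card S = q ^ N := by
  classical
  cases nonempty_fintype S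
  have : Nonempty (Fin q) := ⟨⟨0, hq⟩⟩
  have : Nontrivial (QuditSpace q N) := inferInstance
  let T : S → Module.End ℂ (QuditSpace q N) := fun s => tensorOp fun i => D (s.1 i)
  have hmul : ∀ s t : S, T s * T t = T t * T s := by
    intro s t
    ext1 v
    change tensorOp _ (tensorOp _ v) = tensorOp _ (tensorOp _ v)
    unfold tensorOp
    rw [← toEuclideanLin_mul_apply, hD.tensorMatrix_comm, hS s.1 s.2 t.1 t.2, one_smul,
      toEuclideanLin_mul_apply]
  obtain ⟨v₀, hv₀, χ, hχ⟩ := exists_common_eigenvector T hmul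
  -- The joint eigenvalues obey the same multiplication rule as the operators.
  have hadd : ∀ s t : S, ∃ c : ℂ, (∀ v, T s (T t v) = c • T (s + t) v) ∧
      χ s * χ t = c * χ (s + t) := by
    intro s t
    obtain ⟨c, hc⟩ := hD.exists_tensorMatrix_mul s.1 t.1
    have h1 : ∀ v, T s (T t v) = c • T (s + t) v := by
      intro v
      change tensorOp _ (tensorOp _ v) = c • tensorOp _ v
      unfold tensorOp
      rw [← toEuclideanLin_mul_apply, hc, map_smul]
      rfl
    refine ⟨c, h1, smul_left_injective ℂ hv₀ ?_⟩
    have h2 := h1 v₀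
    rw [hχ t, map_smul, hχ s, hχ (s + t)] at h2
    simp only [mul_smul]
    rw [← h2, smul_comm]
  have hχ0 : ∀ s, χ s ≠ 0 := by
    intro s hs
    have h := inner_eq_of_eigenvector (hD.tensorMatrix_isometry s.1) (hχ s) v₀
    rw [hs, star_zero, zero_mul] at h
    exact hv₀ (inner_self_eq_zero.1 h)
  have hT0 : T 0 = 1 := by
    ext1 v
    change tensorOp _ v = v
    unfold tensorOp
    rw [show (fun i => D ((0 : S).1 i)) = fun i => D ((0 : Fin N → G) i) from rfl,
      hD.tensorMatrix_zero, toEuclideanLin_one_apply]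
  have hχ00 : χ 0 = 1 := by
    have h := hχ 0
    rw [hT0, Module.End.one_apply] at h
    exact smul_left_injective ℂ hv₀ (by simp only [← h, one_smul])
  let Q : Submodule ℂ (QuditSpace q N) := ⨅ s, Module.End.eigenspace (T s) (χ s)
  have hQ : ∀ v, v ∈ Q ↔ ∀ s, T s v = χ s • v := fun v => by
    simp only [Q, Submodule.mem_iInf, Module.End.mem_eigenspace_iff]
  have hcard : (Fintype.card S : ℂ) ≠ 0 := by exact_mod_cast Fintype.card_ne_zero
  let P : Module.End ℂ (QuditSpace q N) := (Fintype.card S : ℂ)⁻¹ • ∑ s, (χ s)⁻¹ • T s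
  have hP : LinearMap.IsProj Q P := by
    constructor
    · intro v
      rw [hQ]
      intro s
      simp only [P, LinearMap.smul_apply, LinearMap.sum_apply, map_smul, map_sum]
      rw [smul_comm (χ s)]
      refine congrArg (fun x => (Fintype.card S : ℂ)⁻¹ • x) ?_
      rw [Finset.smul_sum]
      refine Fintype.sum_equiv (Equiv.addLeft s) _ _ fun t => ?_
      obtain ⟨c, hc, hc'⟩ := hadd s t
      rw [hc, Equiv.coe_addLeft, smul_smul, smul_smul]
      congr 1
      field_simp [hχ0]
      linear_combination -hc'
    · intro v hv
      rw [hQ] at hv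
      simp only [P, LinearMap.smul_apply, LinearMap.sum_apply, hv, smul_smul,
        inv_mul_cancel₀ (hχ0 _), one_smul, Finset.sum_const, Finset.card_univ,
        ← Nat.cast_smul_eq_nsmul ℂ, inv_mul_cancel₀ hcard]
  refine ⟨Q, χ, fun v hv s => (hQ v).1 hv s, ?_⟩
  have htr : LinearMap.trace ℂ _ P = (Fintype.card S : ℂ)⁻¹ * (q : ℂ) ^ N := by
    have hT : ∀ s : S, LinearMap.trace ℂ _ (T s) = (tensorMatrix fun i => D (s.1 i)).trace :=
      fun s => trace_toEuclideanLin _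
    simp only [P, map_smul, map_sum, smul_eq_mul]
    rw [Finset.sum_eq_single 0 (fun s _ hs => by
      rw [hT, hD.trace_tensorMatrix_eq_zero (by simpa using hs), mul_zero]) (by simp), hχ00, hT0,
      LinearMap.trace_one, finrank_euclideanSpace]
    simp
  have h := (LinearMap.IsProj.trace (f := P) hP).symm.trans htr
  rw [Nat.card_eq_fintype_card]
  rw [eq_inv_mul_iff_mul_eq₀ hcard] at h
  rw [mul_comm]
  exact_mod_cast h

end IsNiceErrorBasis

/-! ### The Weyl operators over a finite field -/

section Weyl

variable {K : Type*} [Field K] {q : ℕ}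

/-- The Weyl operator `X(x) Z(z)`, sending the basis vector `|y⟩` to `χ (z y) |y + x⟩`. The basis is
indexed by `K` through `e`. -/
def weylMatrix (χ : AddChar K ℂ) (e : Fin q ≃ K) (a : K × K) : Matrix (Fin q) (Fin q) ℂ :=
  Matrix.of fun i j => open Classical in if e i = e j + a.1 then χ (a.2 * e j) else 0

theorem weylMatrix_mul (χ : AddChar K ℂ) (e : Fin q ≃ K) (a b : K × K) :
    weylMatrix χ e a * weylMatrix χ e b = χ (a.2 * b.1) • weylMatrix χ e (a + b) := by
  classical
  ext i j
  simp only [weylMatrix, Matrix.mul_apply, Matrix.of_apply, Matrix.smul_apply, smul_eq_mul]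
  rw [Finset.sum_eq_single (e.symm (e j + b.1))]
  · simp only [Equiv.apply_symm_apply, if_true, Prod.fst_add, Prod.snd_add]
    by_cases h : e i = e j + (a.1 + b.1)
    · rw [if_pos h, if_pos (by rw [h]; ring), ← AddChar.map_add_eq_mul, ← AddChar.map_add_eq_mul]
      congr 1
      ring
    · rw [if_neg h, if_neg (fun h' => h (by rw [h']; ring))]
      simp
  · intro k _ hk
    rw [if_neg (c := e k = _) (fun h => hk (by rw [← h, Equiv.symm_apply_apply])), mul_zero]
  · simp

theorem isNiceErrorBasis_weylMatrix [Finite K] (χ : AddChar K ℂ) (hχ : χ 1 ≠ 1) (e : Fin q ≃ K) :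
    IsNiceErrorBasis (weylMatrix χ e) fun a b => χ (a.2 * b.1 - b.2 * a.1) := by
  classical
  refine ⟨?_, fun a b => ⟨_, weylMatrix_mul χ e a b⟩, fun a b => ?_, fun a => ?_, fun a ha => ?_⟩
  · ext i j
    simp [weylMatrix, Matrix.one_apply]
  · rw [weylMatrix_mul, weylMatrix_mul, smul_smul, ← AddChar.map_add_eq_mul, sub_add_cancel,
      add_comm b a]
  · ext i j
    simp only [weylMatrix, Matrix.mul_apply, Matrix.conjTranspose_apply, Matrix.of_apply,
      Matrix.one_apply]
    rw [Finset.sum_eq_single (e.symm (e j + a.1))]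
    · simp only [Equiv.apply_symm_apply, if_true, add_left_inj, EmbeddingLike.apply_eq_iff_eq]
      by_cases h : i = j
      · subst h
        simp only [if_true]
        rw [← starRingEnd_apply, ← AddChar.map_neg_eq_conj, ← AddChar.map_add_eq_mul,
          neg_add_cancel, AddChar.map_zero_eq_one]
      · rw [if_neg h, if_neg (Ne.symm h), star_zero, zero_mul]
    · intro k _ hk
      rw [if_neg (c := e k = e j + _) (fun h => hk (by rw [← h, Equiv.symm_apply_apply])),
        mul_zero]
    · simp
  · simp only [weylMatrix, Matrix.trace, Matrix.diag_apply, Matrix.of_apply, left_eq_add]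
    by_cases h1 : a.1 = 0
    · have h2 : a.2 ≠ 0 := fun h2 => ha (Prod.ext h1 h2)
      have hne : χ.mulShift a.2 ≠ 1 := by
        intro h
        have := DFunLike.congr_fun h a.2⁻¹
        rw [AddChar.mulShift_apply, mul_inv_cancel₀ h2, AddChar.one_apply] at this
        exact hχ this
      cases nonempty_fintype K
      simp only [h1, if_true]
      rw [Equiv.sum_comp e fun y => χ (a.2 * y)]
      exact AddChar.sum_eq_zero_of_ne_one hne
    · simp [h1]

theorem IsNiceErrorBasis.comp {G H : Type*} [AddCommGroup G] [AddCommGroup H]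
    {D : G → Matrix (Fin q) (Fin q) ℂ} {β : G → G → ℂ} (hD : IsNiceErrorBasis D β) (φ : H →+ G)
    (hφ : Function.Injective φ) : IsNiceErrorBasis (D ∘ φ) fun a b => β (φ a) (φ b) where
  map_zero := by simp [hD.map_zero]
  map_add a b := by simpa using hD.map_add (φ a) (φ b)
  comm a b := hD.comm (φ a) (φ b)
  conjTranspose_mul_self a := hD.conjTranspose_mul_self (φ a)
  trace_eq_zero a ha := hD.trace_eq_zero (φ a) ((map_ne_zero_iff φ hφ).2 ha)

end Weyl

/-! ### Conjugation on a field with `q ^ 2` elements -/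

section Conjugation

variable {F : Type*} [Field F] [Finite F] {q : ℕ}

theorem one_lt_of_card_eq_sq (hF : Nat.card F = q ^ 2) : 1 < q := by
  have h := Finite.one_lt_card (α := F)
  rw [hF] at h
  by_contra hq
  interval_cases q <;> simp at h

theorem pow_pow_of_card_eq_sq (hF : Nat.card F = q ^ 2) (a : F) : (a ^ q) ^ q = a := by
  cases nonempty_fintype F
  rw [← pow_mul, ← sq, ← hF, Nat.card_eq_fintype_card, FiniteField.pow_card]

/-- On a field with `q ^ 2` elements, `a ↦ a ^ q` is a ring homomorphism. -/
theorem exists_ringHom_eq_pow (hF : Nat.card F = q ^ 2) : ∃ σ : F →+* F, ∀ a, σ a = a ^ q := by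
  cases nonempty_fintype F
  obtain ⟨p, hp, n, hpp, hn⟩ := FiniteField.card' F
  rw [← Nat.card_eq_fintype_card, hF] at hn
  obtain ⟨k, -, hk⟩ := (Nat.dvd_prime_pow hpp).1 (hn ▸ dvd_pow_self q two_ne_zero)
  have : ExpChar F p := ExpChar.prime hpp
  exact ⟨iterateFrobenius F p k, fun a => by rw [iterateFrobenius_def, hk]⟩

theorem ncard_pow_add_mul_eq_zero_le {F : Type*} [Field F] {q : ℕ} (hq : 1 < q) (c : F) :
    {y : F | y ^ q + c * y = 0}.ncard ≤ q := by
  classical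
  have hdeg : (X ^ q + C c * X : F[X]).natDegree = q := by
    have h : (C c * X : F[X]).natDegree < (X ^ q : F[X]).natDegree := by
      rw [natDegree_X_pow]
      exact (natDegree_C_mul_le _ _).trans_lt (by rwa [natDegree_X])
    rw [natDegree_add_eq_left_of_natDegree_lt h, natDegree_X_pow]
  have h0 : (X ^ q + C c * X : F[X]) ≠ 0 := by
    intro h
    rw [h, natDegree_zero] at hdeg
    omega
  calc {y : F | y ^ q + c * y = 0}.ncard
      = ((X ^ q + C c * X : F[X]).roots.toFinset : Set F).ncard := by
        congr 1
        ext y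
        simp [h0]
    _ ≤ Multiset.card (X ^ q + C c * X : F[X]).roots := by
        rw [Set.ncard_coe_finset]
        exact Multiset.toFinset_card_le _
    _ ≤ q := (card_roots' _).trans hdeg.le

/-- The fixed field of conjugation has `q` elements. Both the kernel and the image of `x ↦ x ^ q -
x` are contained in zero sets of polynomials of degree `q`, and their sizes multiply to `q ^ 2`.
-/
theorem card_eqLocusField (hF : Nat.card F = q ^ 2) (σ : F →+* F) (hσ : ∀ a, σ a = a ^ q) :
    Nat.card (σ.eqLocusField (RingHom.id F)) = q := by
  have hq := one_lt_of_card_eq_sq hF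
  let φ : F →+ F := σ.toAddMonoidHom - AddMonoidHom.id F
  have hφ : ∀ a, φ a = a ^ q - a := fun a => by
    change σ a - a = _
    rw [hσ]
  have hker : Nat.card φ.ker = Nat.card (σ.eqLocusField (RingHom.id F)) := by
    refine Nat.card_congr (Equiv.subtypeEquivRight fun a => ?_)
    rw [AddMonoidHom.mem_ker, hφ, RingHom.mem_eqLocusField, hσ, sub_eq_zero, RingHom.id_apply]
  have hle : Nat.card φ.ker ≤ q := by
    refine le_trans (le_of_eq ?_) (ncard_pow_add_mul_eq_zero_le hq (-1 : F))
    rw [← Nat.card_coe_set_eq]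
    refine Nat.card_congr (Equiv.subtypeEquivRight fun a => ?_)
    rw [AddMonoidHom.mem_ker, hφ, Set.mem_ofPred_eq, neg_one_mul, sub_eq_add_neg]
  have hran : Nat.card φ.range ≤ q := by
    refine le_trans ?_ (ncard_pow_add_mul_eq_zero_le hq (1 : F))
    rw [← SetLike.coe_sort_coe, Nat.card_coe_set_eq]
    refine Set.ncard_le_ncard ?_ (Set.toFinite _)
    rintro _ ⟨a, rfl⟩
    rw [hφ, Set.mem_ofPred_eq, ← hσ, map_sub, hσ, hσ, pow_pow_of_card_eq_sq hF]
    ring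
  have hmul : Nat.card φ.range * Nat.card φ.ker = q ^ 2 := by
    rw [← Nat.card_congr (QuotientAddGroup.quotientKerEquivRange φ).toEquiv,
      ← AddSubgroup.card_eq_card_quotient_mul_card_addSubgroup, hF]
  rw [← hker]
  nlinarith

/-- A field with `q ^ 2` elements indexes a nice error basis of `ℂ^q` whose commutation factors
are given by the alternating form `a ^ q b - a b ^ q`, composed with an additive character. The
operators are the Weyl operators, transported along a decomposition `F = K ⊕ γ K` over the fixed
field `K` of conjugation: both summands are isotropic. -/
theorem exists_isNiceErrorBasis (hF : Nat.card F = q ^ 2) :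
    ∃ (D : F → Matrix (Fin q) (Fin q) ℂ) (ψ : AddChar F ℂ), (∃ z, ψ (z ^ q - z) ≠ 1) ∧
      IsNiceErrorBasis D fun a b => ψ (a ^ q * b - a * b ^ q) := by
  have hq := one_lt_of_card_eq_sq hF
  obtain ⟨σ, hσ⟩ := exists_ringHom_eq_pow hF
  set K : Subfield F := σ.eqLocusField (RingHom.id F) with hK
  have hcard : Nat.card K = q := card_eqLocusField hF σ hσ
  have hfix : ∀ x : K, (x : F) ^ q = x := fun x => by
    rw [← hσ]
    exact x.2
  obtain ⟨γ, hγ⟩ : ∃ γ : F, γ ∉ K := by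
    by_contra! h
    have h1 : Nat.card K = Nat.card F :=
      Nat.card_congr ((Equiv.subtypeUnivEquiv h))
    rw [hcard, hF] at h1
    nlinarith
  have hγ' : γ ^ q - γ ≠ 0 := fun h => hγ (by
    rw [hK, RingHom.mem_eqLocusField, hσ]
    exact sub_eq_zero.1 h)
  obtain ⟨ψ, hψ⟩ := AddChar.exists_apply_ne_zero.2 hγ'
  let φ : K × K →+ F :=
    { toFun := fun a => a.1 + γ * a.2
      map_zero' := by simp
      map_add' := fun a b => by
        simp only [Prod.fst_add, Prod.snd_add, Subfield.coe_add]
        ring }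
  have hφ : ∀ a, φ a = a.1 + γ * a.2 := fun _ => rfl
  have hinj : Function.Injective φ := by
    rw [injective_iff_map_eq_zero]
    rintro ⟨x, z⟩ h
    rw [hφ] at h
    simp only at h
    have hz : z = 0 := by
      by_contra hz
      have hz' : (z : F) ≠ 0 := by simpa using hz
      refine hγ ?_
      have : γ = ((-x / z : K) : F) := by
        push_cast
        field_simp
        linear_combination h
      rw [this]
      exact (-x / z : K).2
    subst hz
    simpa using h
  have hbij : Function.Bijective φ := by
    refine (Nat.bijective_iff_injective_and_card φ).2 ⟨hinj, ?_⟩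
    rw [Nat.card_prod, hcard, hF, sq]
  let Φ : K × K ≃+ F := AddEquiv.ofBijective φ hbij
  let χ : AddChar K ℂ := ψ.compAddMonoidHom
    ((AddMonoidHom.mulLeft (γ ^ q - γ)).comp K.subtype.toAddMonoidHom)
  have hχ : ∀ t : K, χ t = ψ ((γ ^ q - γ) * t) := fun _ => rfl
  have e : Fin q ≃ K := (Finite.equivFinOfCardEq hcard).symm
  have hW := (isNiceErrorBasis_weylMatrix χ (by rw [hχ]; simpa using hψ) e).comp
    Φ.symm.toAddMonoidHom Φ.symm.injective
  refine ⟨weylMatrix χ e ∘ Φ.symm.toAddMonoidHom, ψ, ⟨γ, hψ⟩, ?_⟩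
  convert hW using 3 with a b
  obtain ⟨⟨x, z⟩, rfl⟩ := Φ.surjective a
  obtain ⟨⟨x', z'⟩, rfl⟩ := Φ.surjective b
  simp only [AddEquiv.toAddMonoidHom_eq_coe, AddMonoidHom.coe_coe, AddEquiv.symm_apply_apply, hχ]
  congr 1
  change (φ _) ^ q * φ _ - φ _ * (φ _) ^ q = _
  simp only [hφ, ← hσ, map_add, map_mul]
  simp only [hσ, hfix]
  push_cast
  ring

end Conjugation

/-! ### Quantum codes from Hermitian self-orthogonal codes -/

section Quantum

variable {F : Type*} [Field F] {ι : Type*} [Fintype ι] {q : ℕ}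

theorem hermInner_pow [Finite F] (hF : Nat.card F = q ^ 2) (u v : ι → F) :
    hermInner q u v ^ q = hermInner q v u := by
  obtain ⟨σ, hσ⟩ := exists_ringHom_eq_pow hF
  simp only [hermInner, ← hσ, map_sum, map_mul]
  simp only [hσ, pow_pow_of_card_eq_sq hF, mul_comm]

open Classical in
theorem minDist_le_hammingNorm {C : Submodule F (ι → F)} {c : ι → F} (hc : c ∈ C) (h0 : c ≠ 0) :
    minDist C ≤ hammingNorm c :=
  Nat.sInf_le ⟨c, hc, h0, rfl⟩

/-- The stabilizer construction: a Hermitian self-orthogonal code of length `N` and dimension `k`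
yields an `[[N, N - 2k, d]]` quantum code, `d` being the minimum distance of its Hermitian dual.
The code is pure, whatever its dimension. -/
theorem exists_isQECC_of_isHermSelfOrthogonal [Finite F] (hF : Nat.card F = q ^ 2)
    {C : Submodule F (ι → F)} (hC : IsHermSelfOrthogonal q C) {N : ℕ} (hN : Fintype.card ι = N) :
    ∃ Q, IsQECC q N (N - 2 * (Module.finrank F C : ℤ)) (minDist (hermDual q C)) Q := by
  classical
  cases nonempty_fintype F
  have hq := one_lt_of_card_eq_sq hF
  have hq0 : 0 < q := by omega
  obtain ⟨D, ψ, ⟨z, hz⟩, hD⟩ := exists_isNiceErrorBasis hF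
  obtain ⟨σ, hσ⟩ := exists_ringHom_eq_pow hF
  let e : Fin N ≃ ι := (Fintype.equivFinOfCardEq hN).symm
  let L : (ι → F) ≃ₗ[F] (Fin N → F) := LinearEquiv.funCongrLeft F F e
  let S : Submodule F (Fin N → F) := C.map (L : (ι → F) →ₗ[F] (Fin N → F))
  have hcard : Nat.card S.toAddSubgroup = (q ^ 2) ^ Module.finrank F C := by
    rw [← hF, ← Module.natCard_eq_pow_finrank (K := F) (V := C)]
    exact Nat.card_congr (L.submoduleMap C).symm.toEquiv
  -- The commutation factor of two words only depends on their Hermitian inner product.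
  have hβ : ∀ u v : ι → F,
      ∏ i, ψ (L u i ^ q * L v i - L u i * L v i ^ q) =
        ψ (hermInner q u v - hermInner q u v ^ q) := by
    intro u v
    have hsum : ∀ f : Fin N → F, ∏ i, ψ (f i) = ψ (∑ i, f i) := fun f =>
      (map_prod ψ.toMonoidHom (fun i => Multiplicative.ofAdd (f i)) Finset.univ).symm
    rw [hsum, hermInner_pow hF]
    congr 1
    rw [Finset.sum_sub_distrib]
    congr 1
    · exact Equiv.sum_comp e fun i => u i ^ q * v i
    · simp only [mul_comm (L u _)]
      exact Equiv.sum_comp e fun i => v i ^ q * u i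
  obtain ⟨Q, χ, hQ, hdim⟩ := hD.exists_jointEigenspace hq0 (S.toAddSubgroup) (by
    rintro _ ⟨u, hu, rfl⟩ _ ⟨v, hv, rfl⟩
    refine (hβ u v).trans ?_
    rw [hC hv u hu, zero_pow hq0.ne', sub_zero, AddChar.map_zero_eq_one])
  have hpure : ∀ A : Fin N → Matrix (Fin q) (Fin q) ℂ,
      errorWeight A < minDist (hermDual q C) → PureForError Q A := by
    intro A hA
    refine hD.pureForError hq0 (by rw [← Nat.card_eq_fintype_card, hF]) _ Q χ hQ ?_ A hA
    intro w hw hwd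
    obtain ⟨v, rfl⟩ := L.surjective w
    have hv0 : v ≠ 0 := by
      rintro rfl
      exact hw (map_zero L)
    have hnorm : hammingNorm (L v) = hammingNorm v :=
      Finset.card_bij (fun i _ => e i)
        (fun i hi => Finset.mem_filter.2 ⟨Finset.mem_univ _, (Finset.mem_filter.1 hi).2⟩)
        (fun _ _ _ _ h => e.injective h)
        fun i hi => ⟨e.symm i, Finset.mem_filter.2 ⟨Finset.mem_univ _, by
          simpa [L] using (Finset.mem_filter.1 hi).2⟩, by simp⟩
    have hv : ¬ ∀ u ∈ C, hermInner q u v = 0 := fun h =>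
      (hnorm ▸ hwd).not_ge (minDist_le_hammingNorm (C := hermDual q C) h hv0)
    push Not at hv
    obtain ⟨u, hu, huv⟩ := hv
    -- Rescale `u` so that its inner product with `v` becomes `-z`.
    refine ⟨L (((-z / hermInner q u v) ^ q) • u), ⟨_, C.smul_mem _ hu, rfl⟩, ?_⟩
    refine ne_of_eq_of_ne (hβ _ v) ?_
    have h : hermInner q (((-z / hermInner q u v) ^ q) • u) v = -z := by
      have : hermInner q (((-z / hermInner q u v) ^ q) • u) v =
          ((-z / hermInner q u v) ^ q) ^ q * hermInner q u v := by
        simp only [hermInner, Pi.smul_apply, smul_eq_mul, mul_pow, mul_assoc, Finset.mul_sum]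
      rw [this, pow_pow_of_card_eq_sq hF, div_mul_cancel₀ _ huv]
    rw [h, ← hσ, map_neg, hσ, sub_neg_eq_add, neg_add_eq_sub]
    exact hz
  refine ⟨Q, ?_, fun A hA => ⟨_, hpure A hA⟩, fun _ => hpure⟩
  rw [hcard] at hdim
  have hq' : (q : ℚ) ≠ 0 := by exact_mod_cast hq0.ne'
  rw [zpow_sub₀ hq', eq_div_iff (zpow_ne_zero _ hq'), zpow_mul]
  exact_mod_cast hdim

end Quantum

/-! ### The dimension of the quasi-cyclic code -/

section Dimension

variable {F : Type*} [Field F] {n : ℕ}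

theorem bijective_vecToCyc (hn : 0 < n) : Function.Bijective (vecToCyc F n) := by
  have hm : (X ^ n - 1 : F[X]).Monic := by simpa using monic_X_pow_sub_C (1 : F) hn.ne'
  have hdeg : (X ^ n - 1 : F[X]).natDegree = n := by
    simpa using natDegree_X_pow_sub_C (n := n) (r := (1 : F))
  let b := (AdjoinRoot.powerBasis' hm).basis.reindex (finCongr hdeg)
  have h : vecToCyc F n = b.equivFun.symm := by
    refine LinearMap.ext fun v => ?_
    rw [LinearEquiv.coe_coe, Module.Basis.equivFun_symm_apply]
    simp only [vecToCyc, LinearMap.sum_apply, LinearMap.smulRight_apply, LinearMap.proj_apply]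
    refine Finset.sum_congr rfl fun i _ => ?_
    rw [Module.Basis.reindex_apply, PowerBasis.coe_basis]
    rfl
  rw [h]
  exact b.equivFun.symm.bijective

theorem bijective_vecToCyc₂ (hn : 0 < n) : Function.Bijective (vecToCyc₂ F n) := by
  obtain ⟨hi, hs⟩ := bijective_vecToCyc (F := F) hn
  constructor
  · intro u v h
    have h1 := hi (congrArg Prod.fst h)
    have h2 := hi (congrArg Prod.snd h)
    ext (i | i)
    · exact congrFun h1 i
    · exact congrFun h2 i
  · rintro ⟨a, b⟩
    obtain ⟨u, rfl⟩ := hs a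
    obtain ⟨v, rfl⟩ := hs b
    exact ⟨Sum.elim u v, rfl⟩

/-- The one-generator code `C(f, g)` has dimension `n - deg g`: the multiples `h g` with
`deg h < n - deg g` represent every multiple of `g` in `R_n` exactly once. -/
theorem finrank_qcCode_add (hn : 0 < n) (f g : F[X]) (hg : g ∣ X ^ n - 1) :
    Module.finrank F (qcCode n f g) + g.natDegree = n := by
  have hdeg : (X ^ n - 1 : F[X]).natDegree = n := by
    simpa using natDegree_X_pow_sub_C (n := n) (r := (1 : F))
  have hne : (X ^ n - 1 : F[X]) ≠ 0 := fun h => by rw [h, natDegree_zero] at hdeg; omega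
  obtain ⟨k, hk⟩ := hg
  have hg0 : g ≠ 0 := by rintro rfl; exact hne (by rw [hk, zero_mul])
  have hk0 : k ≠ 0 := by rintro rfl; exact hne (by rw [hk, mul_zero])
  have hdk : g.natDegree + k.natDegree = n := by
    rw [← natDegree_mul hg0 hk0, ← hk, hdeg]
  have hbij := bijective_vecToCyc₂ (F := F) hn
  let E : (Fin n ⊕ Fin n → F) ≃ₗ[F] CycRing F n × CycRing F n :=
    LinearEquiv.ofBijective _ hbij
  let mk := AdjoinRoot.mk (X ^ n - 1 : F[X])
  let V := (Submodule.span (CycRing F n) {(mk g, mk (f * g))}).restrictScalars F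
  have h1 : Module.finrank F (qcCode n f g) = Module.finrank F V :=
    (E.submoduleMap (qcCode n f g)).finrank_eq.trans (by
      have : (qcCode n f g).map (E : (Fin n ⊕ Fin n → F) →ₗ[F] _) = V :=
        Submodule.map_comap_eq_of_surjective hbij.2 V
      exact congrArg (fun W : Submodule F (CycRing F n × CycRing F n) => Module.finrank F W) this)
  let M : F[X] →ₗ[F] CycRing F n × CycRing F n :=
    ((AdjoinRoot.mkₐ (X ^ n - 1 : F[X])).toLinearMap ∘ₗ LinearMap.mulRight F g).prod
      ((AdjoinRoot.mkₐ (X ^ n - 1 : F[X])).toLinearMap ∘ₗ LinearMap.mulRight F (f * g))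
  have hM : ∀ h, M h = (mk (h * g), mk (h * (f * g))) := fun h => rfl
  have hker : ∀ h, M h = 0 ↔ k ∣ h := by
    intro h
    rw [hM, Prod.mk_eq_zero]
    simp only [mk, AdjoinRoot.mk_eq_zero]
    rw [hk, mul_comm h g, mul_dvd_mul_iff_left hg0]
    refine ⟨fun H => H.1, fun H => ⟨H, ?_⟩⟩
    rw [mul_comm f g, mul_left_comm]
    exact mul_dvd_mul_left g (H.mul_right f)
  let φ : degreeLT F k.natDegree →ₗ[F] CycRing F n × CycRing F n := M ∘ₗ Submodule.subtype _
  have hinj : Function.Injective φ := by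
    rw [← LinearMap.ker_eq_bot, LinearMap.ker_eq_bot']
    rintro ⟨h, hh⟩ h0
    refine Subtype.ext ?_
    by_contra hne0
    have := (hker h).1 h0
    rw [mem_degreeLT, ← degree_eq_natDegree hk0] at hh
    exact hh.not_ge (degree_le_of_dvd this hne0)
  have hrange : LinearMap.range φ = V := by
    ext v
    simp only [V, Submodule.restrictScalars_mem, Submodule.mem_span_singleton, LinearMap.mem_range]
    constructor
    · rintro ⟨⟨h, hh⟩, rfl⟩
      exact ⟨mk h, by simp only [φ, LinearMap.comp_apply, Submodule.subtype_apply, hM,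
        Prod.smul_mk, smul_eq_mul, mk, map_mul]⟩
    · rintro ⟨r, rfl⟩
      obtain ⟨h, rfl⟩ := AdjoinRoot.mk_surjective r
      refine ⟨⟨h % k, ?_⟩, ?_⟩
      · rw [mem_degreeLT, ← degree_eq_natDegree hk0]
        exact EuclideanDomain.mod_lt h hk0
      · have h2 : M (h % k) = M h := by
          rw [← sub_eq_zero, ← map_sub, hker]
          exact (EuclideanDomain.mod_eq_sub_mul_div h k) ▸ ⟨-(h / k), by ring⟩
        refine h2.trans ?_
        simp only [hM, Prod.smul_mk, smul_eq_mul, mk, map_mul]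
  rw [h1, ← hrange, LinearMap.finrank_range_of_inj hinj, (degreeLTEquiv F _).finrank_eq,
    Module.finrank_fin_fun, add_comm, hdk]

end Dimension

/-! ### Extending a self-orthogonal code -/

section Extension

variable {F : Type*} [Field F] {ι κ : Type*} [Fintype κ] {q : ℕ}

/-- The extension of a code `C`, with coordinates indexed by `ι`, by the rows `(x j, e_j)`, `j :
κ`. -/
def extendCode [DecidableEq κ] (C : Submodule F (ι → F)) (x : κ → ι → F) :
    Submodule F (ι ⊕ κ → F) :=
  Submodule.span F ({w | ∃ c ∈ C, w = Sum.elim c (0 : κ → F)} ∪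
    Set.range fun j => Sum.elim (x j) (Pi.single j 1))

/-- The words of the extended code are `(c + ∑ j, t_j x_j, t)` with `c ∈ C`. -/
theorem mem_extendCode [DecidableEq κ] {C : Submodule F (ι → F)} {x : κ → ι → F}
    {w : ι ⊕ κ → F} :
    w ∈ extendCode C x ↔ w ∘ Sum.inl - ∑ j, w (Sum.inr j) • x j ∈ C := by
  constructor
  · intro hw
    induction hw using Submodule.span_induction with
    | mem w hw =>
      rcases hw with ⟨c, hc, rfl⟩ | ⟨j, rfl⟩
      · simpa using hc
      · simp [Pi.single_apply]
    | zero => simp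
    | add u v _ _ hu hv =>
      convert C.add_mem hu hv using 1
      simp only [Pi.add_apply, add_smul, Finset.sum_add_distrib, Pi.add_comp]
      abel
    | smul a u _ hu =>
      convert C.smul_mem a hu using 1
      simp only [Pi.smul_apply, smul_eq_mul, mul_smul, smul_sub, Finset.smul_sum]
      rfl
  · intro hw
    have h : w = Sum.elim (w ∘ Sum.inl - ∑ j, w (Sum.inr j) • x j) 0 +
        ∑ j, w (Sum.inr j) • Sum.elim (x j) (Pi.single j 1) := by
      ext (i | i)
      · simp [Finset.sum_apply]
      · simp [Finset.sum_apply, Pi.single_apply]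
    rw [h]
    refine Submodule.add_mem _ (Submodule.subset_span (Or.inl ⟨_, hw, rfl⟩))
      (Submodule.sum_mem _ fun j _ =>
        Submodule.smul_mem _ _ (Submodule.subset_span (Or.inr ⟨j, rfl⟩)))

variable [Fintype ι]

theorem hermInner_elim (u v : ι ⊕ κ → F) :
    hermInner q u v =
      hermInner q (u ∘ Sum.inl) (v ∘ Sum.inl) + hermInner q (u ∘ Sum.inr) (v ∘ Sum.inr) :=
  Fintype.sum_sum_type _

/-- Orthogonality to a code can be tested on a spanning set. As `hermInner` is not linear in its
first argument, the proof passes to the conjugate product. -/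
theorem mem_hermDual_span [Finite F] (hF : Nat.card F = q ^ 2) {A : Set (ι → F)} {v : ι → F} :
    v ∈ hermDual q (Submodule.span F A) ↔ ∀ u ∈ A, hermInner q u v = 0 := by
  have hq : q ≠ 0 := by have := one_lt_of_card_eq_sq hF; omega
  refine ⟨fun h u hu => h u (Submodule.subset_span hu), fun h => ?_⟩
  have hle : Submodule.span F A ≤ hermDual q (Submodule.span F {v}) := by
    refine Submodule.span_le.2 fun u hu w hw => ?_
    obtain ⟨a, rfl⟩ := Submodule.mem_span_singleton.1 hw
    have h1 : hermInner q (a • v) u = a ^ q * hermInner q v u := by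
      simp only [hermInner, Pi.smul_apply, smul_eq_mul, mul_pow, mul_assoc, Finset.mul_sum]
    rw [h1, ← hermInner_pow hF, h u hu, zero_pow hq, mul_zero]
  intro u hu
  rw [← hermInner_pow hF, hle hu v (Submodule.mem_span_singleton_self v), zero_pow hq]

open Classical in
theorem exists_hammingNorm_eq_minDist {C : Submodule F (ι → F)} (hC : C ≠ ⊥) :
    ∃ c ∈ C, c ≠ 0 ∧ hammingNorm c = minDist C := by
  obtain ⟨c, hc, h0⟩ := (Submodule.ne_bot_iff _).1 hC
  exact Nat.sInf_mem (s := {w | ∃ c ∈ C, c ≠ 0 ∧ hammingNorm c = w}) ⟨_, c, hc, h0, rfl⟩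

theorem hammingNorm_elim [DecidableEq F] (v : ι ⊕ κ → F) :
    hammingNorm v = hammingNorm (v ∘ Sum.inl) + hammingNorm (v ∘ Sum.inr) := by
  simp only [hammingNorm, Finset.card_filter, Fintype.sum_sum_type, Function.comp_apply]

/-- The Hermitian dual of a self-orthogonal code of positive length is nonzero. -/
theorem hermDual_ne_bot [Nonempty ι] (hq : q ≠ 0) {C : Submodule F (ι → F)}
    (hC : IsHermSelfOrthogonal q C) : hermDual q C ≠ ⊥ := by
  intro h
  have hC0 : C = ⊥ := le_bot_iff.1 (h ▸ hC)
  have htop : hermDual q C = ⊤ := top_unique fun v _ u hu => ?_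
  · exact top_ne_bot (htop.symm.trans h)
  rw [hC0, Submodule.mem_bot] at hu
  simp [hermInner, hu, zero_pow hq]

variable [DecidableEq κ]

theorem finrank_extendCode (C : Submodule F (ι → F)) (x : κ → ι → F) :
    Module.finrank F (extendCode C x) = Module.finrank F C + Fintype.card κ := by
  let φ : extendCode C x ≃ₗ[F] C × (κ → F) :=
    { toFun := fun w => (⟨_, mem_extendCode.1 w.2⟩, w.1 ∘ Sum.inr)
      map_add' := fun u v => by
        refine Prod.ext (Subtype.ext ?_) rfl
        simp only [Submodule.coe_add, Prod.fst_add, Pi.add_apply, add_smul,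
          Finset.sum_add_distrib, Pi.add_comp]
        abel
      map_smul' := fun a u => by
        refine Prod.ext (Subtype.ext ?_) rfl
        simp only [Submodule.coe_smul, Prod.smul_fst, Pi.smul_apply, smul_eq_mul, mul_smul,
          smul_sub, Finset.smul_sum, RingHom.id_apply]
        rfl
      invFun := fun c => ⟨Sum.elim (c.1.1 + ∑ j, c.2 j • x j) c.2, mem_extendCode.2 (by simp)⟩
      left_inv := fun w => by
        refine Subtype.ext ?_
        ext (i | i) <;> simp
      right_inv := fun c => by
        refine Prod.ext (Subtype.ext ?_) ?_
        · simp
        · rfl }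
  rw [φ.finrank_eq, Module.finrank_prod, Module.finrank_fintype_fun_eq_card]

theorem mem_hermDual_extendCode [Finite F] (hF : Nat.card F = q ^ 2) {C : Submodule F (ι → F)}
    {x : κ → ι → F} {v : ι ⊕ κ → F} :
    v ∈ hermDual q (extendCode C x) ↔
      v ∘ Sum.inl ∈ hermDual q C ∧ ∀ j, hermInner q (x j) (v ∘ Sum.inl) + v (Sum.inr j) = 0 := by
  have hq : q ≠ 0 := by have := one_lt_of_card_eq_sq hF; omega
  have h1 : ∀ c : ι → F, hermInner q (Sum.elim c (0 : κ → F)) v = hermInner q c (v ∘ Sum.inl) := by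
    intro c
    rw [hermInner_elim, Sum.elim_comp_inl, Sum.elim_comp_inr]
    simp [hermInner, zero_pow hq]
  have h2 : ∀ j, hermInner q (Sum.elim (x j) (Pi.single j 1)) v =
      hermInner q (x j) (v ∘ Sum.inl) + v (Sum.inr j) := by
    intro j
    rw [hermInner_elim, Sum.elim_comp_inl, Sum.elim_comp_inr]
    simp [hermInner, Pi.single_apply, ite_pow, zero_pow hq]
  rw [extendCode, mem_hermDual_span hF]
  constructor
  · intro h
    exact ⟨fun c hc => (h1 c).symm.trans (h _ (Or.inl ⟨c, hc, rfl⟩)),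
      fun j => (h2 j).symm.trans (h _ (Or.inr ⟨j, rfl⟩))⟩
  · rintro ⟨hC, hx⟩ _ (⟨c, hc, rfl⟩ | ⟨j, rfl⟩)
    · exact (h1 c).trans (hC c hc)
    · exact (h2 j).trans (hx j)

/-- If the rows `x j` are orthogonal to `C` and to each other and satisfy `⟨x j, x j⟩ = -1`, the
extension of a self-orthogonal code is self-orthogonal. -/
theorem isHermSelfOrthogonal_extendCode [Finite F] (hF : Nat.card F = q ^ 2)
    {C : Submodule F (ι → F)} (hC : IsHermSelfOrthogonal q C) {x : κ → ι → F}
    (hx : ∀ j, x j ∈ hermDual q C)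
    (hxx : ∀ i j, hermInner q (x i) (x j) = if i = j then -1 else 0) :
    IsHermSelfOrthogonal q (extendCode C x) := by
  have hq : q ≠ 0 := by have := one_lt_of_card_eq_sq hF; omega
  refine Submodule.span_le.2 ?_
  rintro _ (⟨c, hc, rfl⟩ | ⟨j, rfl⟩)
  · refine (mem_hermDual_extendCode hF).2 ⟨by simpa using hC hc, fun j => ?_⟩
    rw [Sum.elim_comp_inl, ← hermInner_pow hF, hx j c hc, zero_pow hq]
    simp
  · refine (mem_hermDual_extendCode hF).2 ⟨by simpa using hx j, fun i => ?_⟩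
    rw [Sum.elim_comp_inl, hxx]
    simp only [Sum.elim_inr, Pi.single_apply]
    split_ifs <;> simp

/-- Every word of `C^⊥` extends uniquely to the dual of the extended code, with `|κ|` further
coordinates; hence the bounds for the minimum distance. -/
theorem minDist_hermDual_extendCode [Finite F] (hF : Nat.card F = q ^ 2) {C : Submodule F (ι → F)}
    (hC : hermDual q C ≠ ⊥) (x : κ → ι → F) :
    minDist (hermDual q C) ≤ minDist (hermDual q (extendCode C x)) ∧
      minDist (hermDual q (extendCode C x)) ≤ minDist (hermDual q C) + Fintype.card κ := by
  classical
  obtain ⟨u, hu, hu0, hud⟩ := exists_hammingNorm_eq_minDist hC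
  set w : ι ⊕ κ → F := Sum.elim u fun j => -hermInner q (x j) u with hw
  have hwl : w ∘ Sum.inl = u := Sum.elim_comp_inl _ _
  have hwD : w ∈ hermDual q (extendCode C x) := by
    refine (mem_hermDual_extendCode hF).2 ⟨by rwa [hwl], fun j => ?_⟩
    rw [hwl, hw, Sum.elim_inr, add_neg_cancel]
  have hw0 : w ≠ 0 := by
    intro h
    exact hu0 (by rw [← hwl, h]; rfl)
  constructor
  · obtain ⟨v, hv, hv0, hvd⟩ :=
      exists_hammingNorm_eq_minDist (C := hermDual q (extendCode C x))
        ((Submodule.ne_bot_iff _).2 ⟨w, hwD, hw0⟩)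
    obtain ⟨hvC, hvx⟩ := (mem_hermDual_extendCode hF).1 hv
    have hvl : v ∘ Sum.inl ≠ 0 := by
      intro h
      refine hv0 ?_
      ext (i | j)
      · exact congrFun h i
      · have := hvx j
        rw [h] at this
        simpa [hermInner] using this
    rw [← hvd, hammingNorm_elim]
    exact (minDist_le_hammingNorm hvC hvl).trans (Nat.le_add_right _ _)
  · refine (minDist_le_hammingNorm hwD hw0).trans ?_
    rw [hammingNorm_elim, hwl, hud]
    exact Nat.add_le_add_left hammingNorm_le_card_fintype _

/-- The quantum code and the distance bounds obtained from an extended self-orthogonal code. -/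
theorem exists_isQECC_extendCode [Finite F] (hF : Nat.card F = q ^ 2)
    {C : Submodule F (ι → F)} (hC : IsHermSelfOrthogonal q C) (hC' : hermDual q C ≠ ⊥)
    {x : κ → ι → F} (hx : ∀ j, x j ∈ hermDual q C)
    (hxx : ∀ i j, hermInner q (x i) (x j) = if i = j then -1 else 0) {N : ℕ} {k : ℤ}
    (hN : Fintype.card ι + Fintype.card κ = N)
    (hk : N - 2 * (Module.finrank F C + Fintype.card κ : ℤ) = k) :
    (∃ Q, IsQECC q N k (minDist (hermDual q (extendCode C x))) Q) ∧
      minDist (hermDual q C) ≤ minDist (hermDual q (extendCode C x)) ∧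
      minDist (hermDual q (extendCode C x)) ≤ minDist (hermDual q C) + Fintype.card κ := by
  refine ⟨?_, minDist_hermDual_extendCode hF hC' x⟩
  have h := exists_isQECC_of_isHermSelfOrthogonal hF
    (isHermSelfOrthogonal_extendCode hF hC hx hxx) (N := N) (by rw [Fintype.card_sum, hN])
  rwa [finrank_extendCode, Nat.cast_add, hk] at h

end Extension

/-! ### Extensions of the quasi-cyclic code -/

section QuasiCyclicExtension

variable {F : Type*} [Field F] {n q : ℕ}

theorem extCode₁_eq_extendCode (C : Submodule F (Fin n ⊕ Fin n → F)) (x₁ : Fin n → F) :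
    extCode₁ C x₁ = extendCode C fun _ : Fin 1 => Sum.elim x₁ 0 := by
  have h : (![1] : Fin 1 → F) = Pi.single 0 1 := by
    ext i
    fin_cases i
    rfl
  rw [extCode₁, extendCode, Set.range_unique, h]
  rfl

theorem extCode₂_eq_extendCode (C : Submodule F (Fin n ⊕ Fin n → F)) (x₁ x₂ : Fin n → F) :
    extCode₂ C x₁ x₂ = extendCode C ![Sum.elim x₁ 0, Sum.elim 0 x₂] := by
  have h0 : (![1, 0] : Fin 2 → F) = Pi.single 0 1 := by
    ext i
    fin_cases i <;> rfl
  have h1 : (![0, 1] : Fin 2 → F) = Pi.single 1 1 := by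
    ext i
    fin_cases i <;> rfl
  rw [extCode₂, extendCode, h0, h1]
  congr 2
  ext w
  simp [Fin.exists_fin_two, eq_comm]

theorem elim_zero_mem_hermDual {C : Submodule F (Fin n ⊕ Fin n → F)} {x : Fin n → F}
    (hx : x ∈ hermDual q (leftCode C)) : Sum.elim x 0 ∈ hermDual q C := by
  intro c hc
  rw [hermInner_elim, Sum.elim_comp_inl, Sum.elim_comp_inr]
  have h := hx (c ∘ Sum.inl) ⟨c, hc, rfl⟩
  rw [h]
  simp [hermInner]

theorem zero_elim_mem_hermDual {C : Submodule F (Fin n ⊕ Fin n → F)} {x : Fin n → F}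
    (hx : x ∈ hermDual q (rightCode C)) : Sum.elim (0 : Fin n → F) x ∈ hermDual q C := by
  intro c hc
  rw [hermInner_elim, Sum.elim_comp_inl, Sum.elim_comp_inr]
  have h := hx (c ∘ Sum.inr) ⟨c, hc, rfl⟩
  rw [h]
  simp [hermInner]

end QuasiCyclicExtension

end

theorem theorem4 {F : Type*} [Field F] [Finite F] (p q n : ℕ) [CharP F p]
    (hq : IsPrimePow q) (hF : Nat.card F = q ^ 2) (hn : 0 < n)
    (f g : F[X]) (hg : g ∣ X ^ n - 1)
    (hC : IsHermSelfOrthogonal q (qcCode n f g))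
    (x₁ : Fin n → F) (hx₁ : x₁ ∈ hermDual q (leftCode (qcCode n f g)))
    (hx₁' : hermInner q x₁ x₁ = (p : F) - 1) :
    ((∃ Q, IsQECC q (2 * n + 1) (2 * (g.natDegree : ℤ) - 1)
        (minDist (hermDual q (extCode₁ (qcCode n f g) x₁))) Q) ∧
      minDist (hermDual q (qcCode n f g)) ≤
        minDist (hermDual q (extCode₁ (qcCode n f g) x₁)) ∧
      minDist (hermDual q (extCode₁ (qcCode n f g) x₁)) ≤
        minDist (hermDual q (qcCode n f g)) + 1) ∧
    ∀ x₂ : Fin n → F, x₂ ∈ hermDual q (rightCode (qcCode n f g)) →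
      hermInner q x₂ x₂ = (p : F) - 1 →
      ((∃ Q, IsQECC q (2 * n + 2) (2 * (g.natDegree : ℤ) - 2)
          (minDist (hermDual q (extCode₂ (qcCode n f g) x₁ x₂))) Q) ∧
        minDist (hermDual q (qcCode n f g)) ≤
          minDist (hermDual q (extCode₂ (qcCode n f g) x₁ x₂)) ∧
        minDist (hermDual q (extCode₂ (qcCode n f g) x₁ x₂)) ≤
          minDist (hermDual q (qcCode n f g)) + 2) := by
  have hq0 : q ≠ 0 := hq.ne_zero
  have : Nonempty (Fin n) := ⟨⟨0, hn⟩⟩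
  have hC' := hermDual_ne_bot hq0 hC
  have hdim : (Module.finrank F (qcCode n f g) : ℤ) + g.natDegree = n := by
    exact_mod_cast finrank_qcCode_add hn f g hg
  have hp : (p : F) - 1 = -1 := by rw [CharP.cast_eq_zero, zero_sub]
  rw [hp] at hx₁'
  have h₁ : hermInner q (Sum.elim x₁ (0 : Fin n → F)) (Sum.elim x₁ 0) = -1 := by
    rw [hermInner_elim, Sum.elim_comp_inl, Sum.elim_comp_inr, hx₁']
    simp [hermInner]
  constructor
  · rw [extCode₁_eq_extendCode]
    have h := exists_isQECC_extendCode hF hC hC' (x := fun _ : Fin 1 => Sum.elim x₁ 0)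
      (N := 2 * n + 1) (k := 2 * (g.natDegree : ℤ) - 1)
      (fun _ => elim_zero_mem_hermDual hx₁)
      (fun i j => by rw [if_pos (Subsingleton.elim i j)]; exact h₁)
      (by simp only [Fintype.card_sum, Fintype.card_fin]; omega)
      (by simp only [Fintype.card_fin]; push_cast; linarith)
    simpa only [Fintype.card_fin] using h
  · intro x₂ hx₂ hx₂'
    rw [hp] at hx₂'
    have h₂ : hermInner q (Sum.elim (0 : Fin n → F) x₂) (Sum.elim 0 x₂) = -1 := by
      rw [hermInner_elim, Sum.elim_comp_inl, Sum.elim_comp_inr, hx₂']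
      simp [hermInner]
    have h₁₂ : hermInner q (Sum.elim x₁ (0 : Fin n → F)) (Sum.elim 0 x₂) = 0 := by
      simp [hermInner, zero_pow hq0]
    have h₂₁ : hermInner q (Sum.elim (0 : Fin n → F) x₂) (Sum.elim x₁ 0) = 0 := by
      simp [hermInner, zero_pow hq0]
    rw [extCode₂_eq_extendCode]
    have h := exists_isQECC_extendCode hF hC hC' (x := ![Sum.elim x₁ 0, Sum.elim 0 x₂])
      (N := 2 * n + 2) (k := 2 * (g.natDegree : ℤ) - 2)
      (Fin.forall_fin_two.2 ⟨elim_zero_mem_hermDual hx₁, zero_elim_mem_hermDual hx₂⟩)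
      (by simp [Fin.forall_fin_two, h₁, h₂, h₁₂, h₂₁])
      (by simp only [Fintype.card_sum, Fintype.card_fin]; omega)
      (by simp only [Fintype.card_fin]; push_cast; linarith)
    simpa only [Fintype.card_fin] using h
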